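/- Let $\Gamma$ be a finite simplicial graph that is connected and anti-connected (i.e. its opposite graph, with the same vertices and with an edge between two distinct vertices exactly when they are not adjacent in $\Gamma$, is connected). Let $A(\Gamma)$ be the right-angled Artin group generated by the vertices of $\Gamma$ subject to the relations $[v,w]=1$ for all adjacent $v,w$. For a vertex $v$, the star subgroup of $v$ is the subgroup of $A(\Gamma)$ generated by $v$ and all the vertices adjacent to $v$; a subgroup $H\le A(\Gamma)$ is star-free if no nontrivial element of $H$ is conjugate in $A(\Gamma)$ to an element of a star subgroup. Then every finitely generated star-free subgroup $H\le A(\Gamma)$ is undistorted, i.e. quasi-isometrically embedded, in $A(\Gamma)$: for any finite generating sets $S$ of $H$ and $T$ of $A(\Gamma)$, with word metrics $d_S$ and $d_T$, there are constants $K\ge 1$ and $L\ge 0$ such that for all $h_1,h_2\in H$ $$\frac1K\, d_S(h_1,h_2)-L\ \le\ d_T(h_1,h_2)\ \le\ K\, d_S(h_1,h_2)+L .$$ -/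

import Mathlib

namespace RAAG

/-! ### Word metrics and undistorted subgroups -/

/-- The word length of `g` with respect to `S`: the least length of a word in the letters of `S`
and their inverses that represents `g`. (It is used only for `S` generating the group, where
such a word exists for every `g`.) -/
noncomputable def wordLength {G : Type*} [Group G] (S : Set G) (g : G) : ℕ :=
  sInf {n : ℕ | ∃ l : List G, (∀ x ∈ l, x ∈ S ∨ x⁻¹ ∈ S) ∧ l.prod = g ∧ l.length = n}

/-- The (left-invariant) word metric with respect to `S`: the distance from `g` to `h` is the
word length of `g⁻¹ * h`. -/
noncomputable def wordDist {G : Type*} [Group G] (S : Set G) (g h : G) : ℝ :=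
  (wordLength S (g⁻¹ * h) : ℝ)

/-- `f : X → Y` is a quasi-isometric embedding for the distance functions `dX` on `X` and
`dY` on `Y`: for some `K ≥ 1` and `L ≥ 0`, it is a `(K, L)`-quasi-isometric embedding. -/
def IsQuasiIsometricEmbedding {X Y : Type*} (dX : X → X → ℝ) (dY : Y → Y → ℝ)
    (f : X → Y) : Prop :=
  ∃ K L : ℝ, 1 ≤ K ∧ 0 ≤ L ∧ ∀ x₁ x₂ : X,
    1 / K * dX x₁ x₂ - L ≤ dY (f x₁) (f x₂) ∧ dY (f x₁) (f x₂) ≤ K * dX x₁ x₂ + L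

/-- `H` is an undistorted subgroup of `G`: both groups are finitely generated, and the inclusion
is a quasi-isometric embedding with respect to all word metrics on `H` and `G` that come from
finite generating sets. -/
def IsUndistorted {G : Type*} [Group G] (H : Subgroup G) : Prop :=
  Group.FG G ∧ H.FG ∧
    ∀ (S : Set H) (T : Set G), S.Finite → Subgroup.closure S = ⊤ →
      T.Finite → Subgroup.closure T = ⊤ →
        IsQuasiIsometricEmbedding (wordDist S) (wordDist T) (fun h : H => (h : G))

/-! ### Right-angled Artin groups -/

/-- The relators `[v, w]`, for `v` and `w` adjacent in `Γ`. -/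
def relators {V : Type*} (Γ : SimpleGraph V) : Set (FreeGroup V) :=
  {r | ∃ v w : V, Γ.Adj v w ∧
    r = FreeGroup.of v * FreeGroup.of w * (FreeGroup.of v)⁻¹ * (FreeGroup.of w)⁻¹}

/-- The right-angled Artin group `A(Γ)`, generated by the vertices of `Γ`, where adjacent
vertices commute. -/
abbrev Artin {V : Type*} (Γ : SimpleGraph V) : Type _ :=
  PresentedGroup (relators Γ)

/-- The vertex generator of `A(Γ)` given by the vertex `v`. -/
def vertexGen {V : Type*} (Γ : SimpleGraph V) (v : V) : Artin Γ :=
  PresentedGroup.of v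

/-- The star of a vertex `v`: the vertex `v` together with the vertices adjacent to it. -/
def star {V : Type*} (Γ : SimpleGraph V) (v : V) : Set V :=
  {w | w = v ∨ Γ.Adj v w}

/-- The star subgroup of `v`: the subgroup of `A(Γ)` generated by the vertices in the star
of `v`. -/
def starSubgroup {V : Type*} (Γ : SimpleGraph V) (v : V) : Subgroup (Artin Γ) :=
  Subgroup.closure (vertexGen Γ '' star Γ v)

/-- A subgroup `H` of `A(Γ)` is star-free if no nontrivial element of `H` is conjugate in `A(Γ)`
into a star subgroup. -/
def IsStarFree {V : Type*} {Γ : SimpleGraph V} (H : Subgroup (Artin Γ)) : Prop :=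
  ∀ g ∈ H, g ≠ 1 → ∀ (a : Artin Γ) (v : V), a⁻¹ * g * a ∉ starSubgroup Γ v

/-- A graph is anti-connected if its opposite graph, with the same vertices and with an edge
between two distinct vertices exactly when they are not adjacent, is connected. -/
def IsAnticonnected {V : Type*} (Γ : SimpleGraph V) : Prop :=
  Γᶜ.Connected

end RAAG

/-! `A(Γ)` acts on the cosets of star subgroups and carries an integer cocycle on them: a letter
`v^ε` contributes `ε` at the coset of its star. Reduced words show no cancellation, so the `ℓ¹`-norm
of the cocycle is the word length (`l1norm_cocycle_wordProd`); hence the cocycle is proper.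
Star-freeness says exactly that `H` acts freely on these cosets.

For a free action with a proper cocycle, a geodesic of `H` crosses any given coset only during a
bounded time. A long enough segment then has a coset with nonzero net crossing that is crossed
nowhere else; otherwise all its crossings would lie near its two ends and properness would bound its
length. Disjoint segments give distinct such cosets, so the support of the cocycle grows linearly
with length in `H` (`wordLength_le_card_support_of_free_action`). The size of the support is
subadditive on `A(Γ)`, hence at most linear in length there, and the two bounds combine. -/

namespace RAAG

/-! ### Word length -/

section WordLength

variable {G : Type*} [Group G] {S : Set G}

theorem wordLength_le_length (l : List G) (hl : ∀ x ∈ l, x ∈ S ∨ x⁻¹ ∈ S) :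
    wordLength S l.prod ≤ l.length :=
  Nat.sInf_le ⟨l, hl, rfl, rfl⟩

theorem exists_list_length_eq_wordLength (hS : Subgroup.closure S = ⊤) (g : G) :
    ∃ l : List G, (∀ x ∈ l, x ∈ S ∨ x⁻¹ ∈ S) ∧ l.prod = g ∧ l.length = wordLength S g := by
  -- Generation makes this set nonempty, so its infimum is attained rather than the default `0`.
  have hne : {n : ℕ | ∃ l : List G, (∀ x ∈ l, x ∈ S ∨ x⁻¹ ∈ S) ∧ l.prod = g ∧
      l.length = n}.Nonempty := by
    have hg : g ∈ (Subgroup.closure S).toSubmonoid := by simp [hS]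
    rw [Subgroup.closure_toSubmonoid] at hg
    obtain ⟨l, hl, hg⟩ := Submonoid.exists_list_of_mem_closure hg
    exact ⟨l.length, l, hl, hg, rfl⟩
  exact Nat.sInf_mem hne

theorem wordLength_one : wordLength S (1 : G) = 0 := by
  simpa using wordLength_le_length (S := S) [] (by simp)

theorem wordLength_mul_le (hS : Subgroup.closure S = ⊤) (g h : G) :
    wordLength S (g * h) ≤ wordLength S g + wordLength S h := by
  obtain ⟨l, hl, hg, hlen⟩ := exists_list_length_eq_wordLength hS g
  obtain ⟨l', hl', hh, hlen'⟩ := exists_list_length_eq_wordLength hS h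
  have := wordLength_le_length (S := S) (l ++ l') (by
    intro x hx
    rcases List.mem_append.1 hx with hx | hx
    exacts [hl x hx, hl' x hx])
  simpa [hg, hh, hlen, hlen'] using this

theorem finite_setOf_mem_or_inv_mem (hfin : S.Finite) : {x | x ∈ S ∨ x⁻¹ ∈ S}.Finite := by
  have : {x | x ∈ S ∨ x⁻¹ ∈ S} = S ∪ S⁻¹ := by ext; simp
  rw [this]
  exact hfin.union hfin.inv

/-- A subadditive function on a group is bounded by a multiple of the word length with respect to
a finite generating set. -/
theorem exists_le_mul_wordLength (hfin : S.Finite) (hS : Subgroup.closure S = ⊤)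
    (f : G → ℕ) (hone : f 1 = 0) (hmul : ∀ x y, f (x * y) ≤ f x + f y) :
    ∃ C : ℕ, ∀ g, f g ≤ C * wordLength S g := by
  obtain ⟨C, hC⟩ := ((finite_setOf_mem_or_inv_mem hfin).image f).bddAbove
  refine ⟨C, fun g => ?_⟩
  obtain ⟨l, hl, rfl, hlen⟩ := exists_list_length_eq_wordLength hS g
  rw [← hlen]
  clear hlen
  induction l with
  | nil => simp [hone]
  | cons x l ih =>
    have h1 : f x ≤ C := hC ⟨x, hl x (by simp), rfl⟩
    have h2 := ih fun y hy => hl y (by simp [hy])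
    have h3 := hmul x l.prod
    rw [List.prod_cons, List.length_cons, mul_add]
    omega

end WordLength

/-! ### Free actions with proper cocycles -/

/-- The `ℓ¹`-norm of a finitely supported integer function. -/
def l1norm {J : Type*} (f : J →₀ ℤ) : ℕ :=
  f.sum fun _ z => z.natAbs

theorem l1norm_le {J : Type*} (f : J →₀ ℤ) (M N : ℕ) (hM : f.support.card ≤ M)
    (hN : ∀ j ∈ f.support, (f j).natAbs ≤ N) : l1norm f ≤ M * N := by
  calc l1norm f ≤ f.support.card • N := Finset.sum_le_card_nsmul _ _ _ hN
    _ ≤ M * N := by rw [smul_eq_mul]; gcongr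

/-- Let a group act freely on a set `J` and let `c` be a proper cocycle with values in the finitely
supported integer functions on `J`. Then the word length of `x` is bounded linearly in the size of
the support of `c x`. -/
theorem wordLength_le_card_support_of_free_action {H J : Type*} [Group H] [MulAction H J]
    {S : Set H} (hfin : S.Finite) (hS : Subgroup.closure S = ⊤)
    (hfree : ∀ (x : H) (j : J), x • j = j → x = 1) (c : H → J →₀ ℤ)
    (hc : ∀ x y j, c (x * y) j = c x j + c y (x⁻¹ • j))
    (hproper : ∀ M : ℕ, {x | l1norm (c x) ≤ M}.Finite) :
    ∃ R : ℕ, ∀ x, wordLength S x ≤ R * ((c x).support.card + 1) := by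
  classical
  have hSfin := finite_setOf_mem_or_inv_mem hfin
  set S' : Finset H := hSfin.toFinset
  set F : Finset J := S'.biUnion fun s => (c s).support
  obtain ⟨B, hB⟩ : ∃ B : ℕ, ∀ s ∈ S', ∀ j, (c s j).natAbs ≤ B := by
    refine ⟨∑ s ∈ S', ∑ j ∈ (c s).support, (c s j).natAbs, fun s hs j => ?_⟩
    by_cases hj : c s j = 0
    · simp [hj]
    · calc (c s j).natAbs ≤ ∑ j ∈ (c s).support, (c s j).natAbs :=
            Finset.single_le_sum (f := fun j => (c s j).natAbs) (by simp) (by simpa using hj)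
        _ ≤ _ := Finset.single_le_sum
            (f := fun s => ∑ j ∈ (c s).support, (c s j).natAbs) (by simp) hs
  -- By freeness at most one `g` carries a given point of `F` to another given one, so only finitely
  -- many `g` occur.
  obtain ⟨D, hD⟩ : ∃ D : ℕ, ∀ g : H, ∀ f ∈ F, g • f ∈ F → wordLength S g ≤ D := by
    have hE : {g : H | ∃ f ∈ F, g • f ∈ F}.Finite := by
      have : {g : H | ∃ f ∈ F, g • f ∈ F} ⊆ ⋃ q ∈ F ×ˢ F, {g : H | g • q.1 = q.2} := by
        rintro g ⟨f, hf, hgf⟩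
        exact Set.mem_biUnion (x := (f, g • f)) (by simp [hf, hgf]) rfl
      refine Set.Finite.subset (Set.Finite.biUnion (Finset.finite_toSet _) fun q _ => ?_) this
      refine Set.Subsingleton.finite fun g hg g' hg' => ?_
      have := hfree (g'⁻¹ * g) q.1 (by
        rw [mul_smul, show g • q.1 = q.2 from hg, ← show g' • q.1 = q.2 from hg', inv_smul_smul])
      exact (inv_mul_eq_one.1 this).symm
    obtain ⟨D, hD⟩ := (hE.image (wordLength S)).bddAbove
    exact ⟨D, fun g f hf hgf => hD ⟨g, ⟨f, hf, hgf⟩, rfl⟩⟩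
  -- The argument of `hproper` bounds the norm of a segment crossed only near its ends: at most `2 *
  -- D * F.card` points, each of value at most `(2 * D + 1) * B`. Such segments have length at most
  -- `R`, so length `R + 1` is impossible for them.
  obtain ⟨R, hR⟩ := ((hproper ((D + D) * F.card * ((2 * D + 1) * B))).image
    (wordLength S)).bddAbove
  refine ⟨R + 1, fun x => ?_⟩
  obtain ⟨l, hl, hx, hn⟩ := exists_list_length_eq_wordLength hS x
  set n := wordLength S x
  set p : ℕ → H := fun i => (l.take i).prod
  have hp0 : p 0 = 1 := by simp [p]
  have hpn : p n = x := by simp [p, ← hn, hx]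
  have hstep : ∀ k, k < n → ∃ s ∈ S', p (k + 1) = p k * s := by
    intro k hk
    refine ⟨l[k], by simpa [S'] using hl _ (List.getElem_mem _), ?_⟩
    simp only [p]
    rw [List.prod_take_succ]
  -- Subwords of a geodesic word are geodesic.
  have hgeod : ∀ i j, i ≤ j → j ≤ n → j - i ≤ wordLength S ((p i)⁻¹ * p j) := by
    intro i j hij hj
    have h1 : wordLength S (p i) ≤ i :=
      (wordLength_le_length _ fun y hy => hl y (List.mem_of_mem_take hy)).trans (by simp)
    have h2 : wordLength S ((p j)⁻¹ * x) ≤ n - j := by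
      have : (p j)⁻¹ * x = (l.drop j).prod := by
        rw [inv_mul_eq_iff_eq_mul, ← hx, List.prod_take_mul_prod_drop]
      rw [this]
      exact (wordLength_le_length _ fun y hy => hl y (List.mem_of_mem_drop hy)).trans
        (by simp [hn])
    have h3 := wordLength_mul_le hS (p i) ((p i)⁻¹ * p j)
    have h4 := wordLength_mul_le hS (p j) ((p j)⁻¹ * x)
    simp only [mul_inv_cancel_left] at h3 h4
    omega
  set e : ℕ → J → ℤ := fun k j => c (p (k + 1)) j - c (p k) j
  have he : ∀ k, k < n → ∃ s ∈ S', ∀ j, e k j = c s ((p k)⁻¹ • j) := by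
    intro k hk
    obtain ⟨s, hs, h⟩ := hstep k hk
    exact ⟨s, hs, fun j => by simp [e, h, hc]⟩
  have heF : ∀ k, k < n → ∀ j, e k j ≠ 0 → (p k)⁻¹ • j ∈ F := by
    intro k hk j hj
    obtain ⟨s, hs, h⟩ := he k hk
    exact Finset.mem_biUnion.2 ⟨s, hs, by simpa [← h] using hj⟩
  have heB : ∀ k, k < n → ∀ j, (e k j).natAbs ≤ B := by
    intro k hk j
    obtain ⟨s, hs, h⟩ := he k hk
    rw [h]
    exact hB s hs _
  -- If steps `k ≤ k'` both cross `j`, then `(p k)⁻¹ * p k'` moves a point of `F` into `F`, so its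
  -- length, at least `k' - k`, is at most `D`.
  have heD : ∀ k k', k < n → k' < n → ∀ j, e k j ≠ 0 → e k' j ≠ 0 → k' ≤ k + D := by
    intro k k' hk hk' j hj hj'
    rcases le_total k k' with h | h
    · have h1 := hgeod k k' h hk'.le
      have h2 := hD ((p k)⁻¹ * p k') ((p k')⁻¹ • j) (heF k' hk' j hj')
        (by simpa [mul_smul] using heF k hk j hj)
      omega
    · omega
  have hsum : ∀ a b, a ≤ b → ∀ j, c (p b) j - c (p a) j = ∑ k ∈ Finset.Ico a b, e k j := by
    intro a b hab j
    exact (Finset.sum_Ico_sub (fun k => c (p k) j) hab).symm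
  have hmain : ∀ a, a + (R + 1) ≤ n → ∃ j, c (p (a + (R + 1))) j - c (p a) j ≠ 0 ∧
      ∀ k < n, e k j ≠ 0 → a ≤ k ∧ k < a + (R + 1) := by
    intro a ha
    by_contra! hcon
    set b := a + (R + 1)
    set g := (p a)⁻¹ * p b
    have hg : ∀ j, c g j = c (p b) (p a • j) - c (p a) (p a • j) := by
      intro j
      have := hc (p a) g (p a • j)
      simp only [g, mul_inv_cancel_left, inv_smul_smul] at this ⊢
      omega
    -- A point crossed both inside and outside `[a, b)` is crossed, inside, within `D` of an end, by
    -- `heD`.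
    set K : Finset ℕ := Finset.Ico a (a + D) ∪ Finset.Ico (b - D) b
    have hcross : ∀ j ∈ (c g).support, ∃ k ∈ K, k < n ∧ e k (p a • j) ≠ 0 := by
      intro j hj
      rw [Finsupp.mem_support_iff, hg] at hj
      obtain ⟨k', hk', hek', hout⟩ := hcon _ hj
      rw [hsum a b (by omega)] at hj
      obtain ⟨k, hk, hek⟩ := Finset.exists_ne_zero_of_sum_ne_zero hj
      rw [Finset.mem_Ico] at hk
      have hkn : k < n := by omega
      have h1 := heD k k' hkn hk' _ hek hek'
      have h2 := heD k' k hk' hkn _ hek' hek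
      refine ⟨k, ?_, hkn, hek⟩
      simp only [K, Finset.mem_union, Finset.mem_Ico]
      by_cases hak : a ≤ k'
      · have := hout hak
        omega
      · omega
    have hcard : (c g).support.card ≤ (D + D) * F.card := by
      have hsub : (c g).support ⊆
          (K ×ˢ F).image fun q => (p a)⁻¹ • p q.1 • q.2 := by
        intro j hj
        obtain ⟨k, hkK, hkn, hek⟩ := hcross j hj
        exact Finset.mem_image.2 ⟨(k, (p k)⁻¹ • p a • j),
          by simpa [hkK] using heF k hkn _ hek, by simp⟩
      have hK : K.card ≤ D + D := by
        refine (Finset.card_union_le _ _).trans ?_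
        simp only [Nat.card_Ico]
        omega
      calc (c g).support.card ≤ (K ×ˢ F).card :=
            (Finset.card_le_card hsub).trans Finset.card_image_le
        _ = K.card * F.card := Finset.card_product _ _
        _ ≤ _ := by gcongr
    have hval : ∀ j ∈ (c g).support, (c g j).natAbs ≤ (2 * D + 1) * B := by
      intro j hj
      obtain ⟨k, -, hkn, hek⟩ := hcross j hj
      rw [hg, hsum a b (by omega)]
      set I := (Finset.Ico a b).filter fun i => e i (p a • j) ≠ 0
      -- All crossings of one point lie within `D` of the crossing `k`.
      have hI : I.card ≤ 2 * D + 1 := by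
        have : I ⊆ Finset.Ico (k - D) (k + D + 1) := by
          intro i hi
          simp only [I, Finset.mem_filter, Finset.mem_Ico] at hi
          have h1 := heD k i hkn (by omega) _ hek hi.2
          have h2 := heD i k (by omega) hkn _ hi.2 hek
          rw [Finset.mem_Ico]
          omega
        refine (Finset.card_le_card this).trans ?_
        rw [Nat.card_Ico]
        omega
      rw [← Finset.sum_filter_ne_zero]
      calc (∑ i ∈ I, e i (p a • j)).natAbs ≤ ∑ i ∈ I, (e i (p a • j)).natAbs :=
            Int.natAbs_sum_le _ _
        _ ≤ I.card • B := Finset.sum_le_card_nsmul _ _ _ fun i hi => by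
            simp only [I, Finset.mem_filter, Finset.mem_Ico] at hi
            exact heB i (by omega) _
        _ ≤ _ := by rw [smul_eq_mul]; gcongr
    have h1 : wordLength S g ≤ R := hR ⟨g, l1norm_le _ _ _ hcard hval, rfl⟩
    have h2 : b - a ≤ wordLength S g := hgeod a b (by omega) ha
    omega
  have hc1 : ∀ j, c 1 j = 0 := fun j => by simpa using hc 1 1 j
  have hseg : ∀ t : Fin (n / (R + 1)), (t + 1 : ℕ) * (R + 1) ≤ n := fun t =>
    (Nat.mul_le_mul_right _ t.2).trans (Nat.div_mul_le_self _ _)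
  -- The word is cut into consecutive segments of length `R + 1`; an incomplete last one is dropped,
  -- which costs the `+ 1` in the final bound.
  choose j hj hout using fun t : Fin (n / (R + 1)) =>
    hmain (t * (R + 1)) (by have := hseg t; rw [add_mul] at this; omega)
  have hinside : ∀ t, ∃ k < n, e k (j t) ≠ 0 := by
    intro t
    have h := hj t
    rw [hsum _ _ (by omega)] at h
    obtain ⟨k, hk, hek⟩ := Finset.exists_ne_zero_of_sum_ne_zero h
    have := hseg t
    rw [add_mul] at this
    exact ⟨k, by rw [Finset.mem_Ico] at hk; omega, hek⟩
  have hinj : Function.Injective j := by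
    intro t t' htt'
    obtain ⟨k, hk, hek⟩ := hinside t
    have h1 := hout t k hk hek
    have h2 := hout t' k hk (htt' ▸ hek)
    have hdiv : ∀ t : ℕ, t * (R + 1) ≤ k ∧ k < t * (R + 1) + (R + 1) → k / (R + 1) = t := by
      intro t ht
      exact Nat.div_eq_of_lt_le ht.1 (by rw [add_mul]; omega)
    exact Fin.ext ((hdiv _ h1).symm.trans (hdiv _ h2))
  have hsupp : ∀ t, j t ∈ (c x).support := by
    intro t
    have h := hsum 0 n (by omega) (j t)
    rw [hp0, hpn, hc1, sub_zero] at h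
    have hle := hseg t
    rw [add_mul] at hle
    -- No step outside the segment crosses `j t`, so its net crossing over the segment is already
    -- the value of `c x` there.
    have hsub : ∑ k ∈ Finset.Ico (t * (R + 1) : ℕ) (t * (R + 1) + (R + 1)), e k (j t) =
        ∑ k ∈ Finset.Ico 0 n, e k (j t) := by
      refine Finset.sum_subset (fun k hk => ?_) fun k hk hk' => ?_
      · rw [Finset.mem_Ico] at hk ⊢
        omega
      · by_contra hek
        exact hk' (Finset.mem_Ico.2 (hout t k (Finset.mem_Ico.1 hk).2 hek))
    rw [Finsupp.mem_support_iff, h, ← hsub, ← hsum _ _ (by omega)]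
    exact hj t
  have hcard : n / (R + 1) ≤ (c x).support.card := by
    have := Finset.card_le_card_of_injOn (s := Finset.univ) j (fun t _ => hsupp t) hinj.injOn
    simpa using this
  calc n ≤ (R + 1) * (n / (R + 1) + 1) := (Nat.lt_mul_div_succ n (by omega)).le
    _ ≤ _ := by gcongr
-- Star cosets and their cocycle
section Cocycle

variable {V : Type*} (Γ : SimpleGraph V)

/-- The cosets of the star subgroups, on which `A(Γ)` acts by left multiplication. -/
abbrev StarCoset : Type _ := Σ v : V, Artin Γ ⧸ starSubgroup Γ v

/-- The star subgroup of `v`, as a point of `StarCoset Γ`. -/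
def baseCoset (v : V) : StarCoset Γ := ⟨v, ((1 : Artin Γ) : Artin Γ ⧸ starSubgroup Γ v)⟩

variable {Γ}

theorem smul_sigma_mk_eq_iff (g a : Artin Γ) (v : V) :
    g • (⟨v, (a : Artin Γ ⧸ starSubgroup Γ v)⟩ : StarCoset Γ) = ⟨v, a⟩ ↔
      a⁻¹ * g * a ∈ starSubgroup Γ v := by
  rw [Sigma.smul_mk, Sigma.mk.injEq]
  simp only [heq_eq_eq, true_and]
  rw [eq_comm, MulAction.Quotient.smul_coe, QuotientGroup.eq, smul_eq_mul, mul_assoc]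

theorem smul_baseCoset_eq_iff (g : Artin Γ) (v : V) :
    g • baseCoset Γ v = baseCoset Γ v ↔ g ∈ starSubgroup Γ v := by
  refine (smul_sigma_mk_eq_iff g 1 v).trans ?_
  simp

theorem vertexGen_mem_starSubgroup_self (v : V) : vertexGen Γ v ∈ starSubgroup Γ v :=
  Subgroup.subset_closure ⟨v, Or.inl rfl, rfl⟩

theorem vertexGen_mem_starSubgroup {v w : V} (h : Γ.Adj w v) :
    vertexGen Γ v ∈ starSubgroup Γ w :=
  Subgroup.subset_closure ⟨v, Or.inr h, rfl⟩

theorem vertexGen_commute {v w : V} (h : Γ.Adj v w) :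
    Commute (vertexGen Γ v) (vertexGen Γ w) := by
  have := PresentedGroup.one_of_mem (rels := relators Γ) ⟨v, w, h, rfl⟩
  simp only [map_mul, map_inv] at this
  rw [mul_inv_eq_one, mul_inv_eq_iff_eq_mul] at this
  exact this

theorem closure_range_vertexGen : Subgroup.closure (Set.range (vertexGen Γ)) = ⊤ :=
  PresentedGroup.closure_range_of _

/-- A vertex is central in its star subgroup. -/
theorem vertexGen_commute_of_mem_starSubgroup {v : V} {g : Artin Γ}
    (hg : g ∈ starSubgroup Γ v) : Commute (vertexGen Γ v) g := by
  have : starSubgroup Γ v ≤ Subgroup.centralizer {vertexGen Γ v} := by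
    refine (Subgroup.closure_le _).2 ?_
    rintro _ ⟨w, rfl | hw, rfl⟩
    · simp [Subgroup.mem_centralizer_iff]
    · simpa [Subgroup.mem_centralizer_iff] using (vertexGen_commute hw).eq
  exact Subgroup.mem_centralizer_iff.1 (this hg) _ rfl

variable (Γ)

/-- The action of `A(Γ)` on finitely supported functions on `StarCoset Γ`. -/
noncomputable def shift (g : Artin Γ) : (StarCoset Γ →₀ ℤ) ≃+ (StarCoset Γ →₀ ℤ) :=
  Finsupp.domCongr (MulAction.toPerm g)

variable {Γ}

@[simp]
theorem shift_apply (g : Artin Γ) (f : StarCoset Γ →₀ ℤ) (j : StarCoset Γ) :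
    shift Γ g f j = f (g⁻¹ • j) := rfl

theorem shift_mul (g h : Artin Γ) (f : StarCoset Γ →₀ ℤ) :
    shift Γ (g * h) f = shift Γ g (shift Γ h f) := by
  ext j
  simp [mul_smul]

theorem shift_single (g : Artin Γ) (j : StarCoset Γ) (n : ℤ) :
    shift Γ g (Finsupp.single j n) = Finsupp.single (g • j) n :=
  Finsupp.equivMapDomain_single _ _ _

theorem l1norm_shift (g : Artin Γ) (f : StarCoset Γ →₀ ℤ) :
    l1norm (shift Γ g f) = l1norm f :=
  Finsupp.sum_equivMapDomain (MulAction.toPerm g) f fun _ z => z.natAbs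

variable (Γ)

/-- The affine transformation of the functions on `StarCoset Γ` given by a vertex. -/
noncomputable def affineGen (v : V) : Equiv.Perm (StarCoset Γ →₀ ℤ) :=
  (shift Γ (vertexGen Γ v)).toEquiv.trans (Equiv.addLeft (Finsupp.single (baseCoset Γ v) 1))

variable {Γ}

theorem affineGen_apply (v : V) (f : StarCoset Γ →₀ ℤ) :
    affineGen Γ v f = Finsupp.single (baseCoset Γ v) 1 + shift Γ (vertexGen Γ v) f := rfl

/-- Each of two adjacent vertices lies in the star of the other and so fixes its base coset: neither
linear part moves the other's translation vector. -/
theorem affineGen_commute {v w : V} (h : Γ.Adj v w) :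
    Commute (affineGen Γ v) (affineGen Γ w) := by
  ext1 f
  simp only [Equiv.Perm.mul_apply, affineGen_apply, map_add, shift_single, ← shift_mul,
    (vertexGen_commute h).eq, (smul_baseCoset_eq_iff _ _).2 (vertexGen_mem_starSubgroup h),
    (smul_baseCoset_eq_iff _ _).2 (vertexGen_mem_starSubgroup h.symm)]
  exact add_left_comm _ _ _

variable (Γ)

/-- The action of `A(Γ)` by affine transformations whose translation part is `cocycle Γ`. -/
noncomputable def affineHom : Artin Γ →* Equiv.Perm (StarCoset Γ →₀ ℤ) :=
  PresentedGroup.toGroup (f := affineGen Γ) (by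
    rintro _ ⟨v, w, h, rfl⟩
    simp only [map_mul, map_inv, FreeGroup.lift_apply_of]
    rw [(affineGen_commute h).eq, mul_inv_cancel_right, mul_inv_cancel])

/-- The cocycle that counts, with signs, how often a word crosses the cosets of star subgroups. -/
noncomputable def cocycle (g : Artin Γ) : StarCoset Γ →₀ ℤ := affineHom Γ g 0

variable {Γ}

theorem affineHom_vertexGen (v : V) : affineHom Γ (vertexGen Γ v) = affineGen Γ v :=
  PresentedGroup.toGroup.of _

/-- The linear part of the affine action is `shift`; the cocycle identity follows by evaluating a
product at `0`. -/
theorem affineHom_apply (g : Artin Γ) :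
    ∀ f, affineHom Γ g f = cocycle Γ g + shift Γ g f := by
  have hg : g ∈ Subgroup.closure (Set.range (vertexGen Γ)) := by simp [closure_range_vertexGen]
  unfold cocycle
  induction hg using Subgroup.closure_induction with
  | mem x hx =>
    obtain ⟨v, rfl⟩ := hx
    intro f
    simp [affineHom_vertexGen, affineGen_apply]
  | one =>
    intro f
    ext j
    simp
  | mul x y _ _ hx hy =>
    intro f
    rw [map_mul, Equiv.Perm.mul_apply, Equiv.Perm.mul_apply, hx, hy, hx (affineHom Γ y 0),
      map_add, shift_mul, add_assoc]
  | inv x _ hx =>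
    have h : ∀ f, affineHom Γ x⁻¹ f = shift Γ x⁻¹ (f - affineHom Γ x 0) := by
      intro f
      rw [map_inv, Equiv.Perm.inv_eq_iff_eq, hx, ← shift_mul]
      ext j
      simp
    intro f
    rw [h, h 0, ← map_add]
    congr 1
    abel

theorem cocycle_mul (g h : Artin Γ) : cocycle Γ (g * h) = cocycle Γ g + shift Γ g (cocycle Γ h) := by
  rw [← affineHom_apply, cocycle, map_mul, Equiv.Perm.mul_apply, cocycle]

theorem cocycle_mul_apply (g h : Artin Γ) (j : StarCoset Γ) :
    cocycle Γ (g * h) j = cocycle Γ g j + cocycle Γ h (g⁻¹ • j) := by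
  rw [cocycle_mul, Finsupp.add_apply, shift_apply]

theorem cocycle_one : cocycle Γ 1 = 0 := by simp [cocycle]

theorem cocycle_vertexGen (v : V) :
    cocycle Γ (vertexGen Γ v) = Finsupp.single (baseCoset Γ v) 1 := by
  simp [cocycle, affineHom_vertexGen, affineGen_apply]

/-- The inverse letter is recorded at the same coset because `v` lies in its own star subgroup. -/
theorem cocycle_vertexGen_inv (v : V) :
    cocycle Γ (vertexGen Γ v)⁻¹ = Finsupp.single (baseCoset Γ v) (-1) := by
  have h := cocycle_mul (vertexGen Γ v)⁻¹ (vertexGen Γ v)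
  rw [inv_mul_cancel, cocycle_one, cocycle_vertexGen, shift_single,
    (smul_baseCoset_eq_iff _ _).2 (inv_mem (vertexGen_mem_starSubgroup_self v))] at h
  rw [eq_neg_of_add_eq_zero_left h.symm, Finsupp.single_neg]

theorem card_support_cocycle_mul_le (g h : Artin Γ) :
    (cocycle Γ (g * h)).support.card ≤
      (cocycle Γ g).support.card + (cocycle Γ h).support.card := by
  classical
  rw [cocycle_mul]
  refine (Finset.card_le_card Finsupp.support_add).trans ((Finset.card_union_le _ _).trans ?_)
  exact Nat.add_le_add_left (Finset.card_map _).le _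

/-! ### Words, and properness of the cocycle -/

variable (Γ)

/-- The element of `A(Γ)` given by a vertex or the inverse of a vertex. -/
def letter (x : V × ℤˣ) : Artin Γ := vertexGen Γ x.1 ^ (x.2 : ℤ)

/-- The element of `A(Γ)` given by a word. -/
def wordProd (l : List (V × ℤˣ)) : Artin Γ := (l.map (letter Γ)).prod

variable {Γ}

@[simp] theorem wordProd_nil : wordProd Γ [] = 1 := rfl

@[simp] theorem wordProd_cons (x : V × ℤˣ) (l : List (V × ℤˣ)) :
    wordProd Γ (x :: l) = letter Γ x * wordProd Γ l := by simp [wordProd]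

@[simp] theorem wordProd_append (l l' : List (V × ℤˣ)) :
    wordProd Γ (l ++ l') = wordProd Γ l * wordProd Γ l' := by simp [wordProd]

theorem letter_mem_starSubgroup (x : V × ℤˣ) : letter Γ x ∈ starSubgroup Γ x.1 :=
  zpow_mem (vertexGen_mem_starSubgroup_self _) _

theorem cocycle_letter (x : V × ℤˣ) :
    cocycle Γ (letter Γ x) = Finsupp.single (baseCoset Γ x.1) (x.2 : ℤ) := by
  obtain ⟨v, ε⟩ := x
  rcases Int.units_eq_one_or ε with rfl | rfl
  · simp [letter, cocycle_vertexGen]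
  · simp [letter, cocycle_vertexGen_inv]

theorem exists_wordProd_eq (g : Artin Γ) : ∃ l, wordProd Γ l = g := by
  obtain ⟨l, hl, rfl, -⟩ := exists_list_length_eq_wordLength closure_range_vertexGen g
  induction l with
  | nil => exact ⟨[], rfl⟩
  | cons x l ih =>
    obtain ⟨l', hl'⟩ := ih fun y hy => hl y (by simp [hy])
    rcases hl x (by simp) with ⟨v, hv⟩ | ⟨v, hv⟩
    · exact ⟨(v, 1) :: l', by simp [letter, hv, hl']⟩
    · exact ⟨(v, -1) :: l', by simp [letter, hv, hl']⟩

/-- If the cocycle of a word has sign `-ε` at a coset, some letter of sign `-ε` crosses it. -/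
theorem exists_crossing (ε : ℤˣ) (l : List (V × ℤˣ)) (j : StarCoset Γ)
    (h : (ε : ℤ) * cocycle Γ (wordProd Γ l) j < 0) :
    ∃ (m m' : List (V × ℤˣ)) (v : V), l = m ++ (v, -ε) :: m' ∧
      wordProd Γ m • baseCoset Γ v = j := by
  induction l generalizing j with
  | nil => simp [cocycle_one] at h
  | cons x l ih =>
    obtain ⟨w, δ⟩ := x
    rw [wordProd_cons, cocycle_mul_apply, cocycle_letter, mul_add] at h
    -- Either the first letter is the crossing sought, or its contribution does not have sign `-ε`
    -- and the negativity comes from the tail.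
    by_cases hx : baseCoset Γ w = j ∧ δ = -ε
    · exact ⟨[], l, w, by simp [hx.2], by simp [hx.1]⟩
    · have hx' : 0 ≤ (ε : ℤ) * Finsupp.single (baseCoset Γ w) (δ : ℤ) j := by
        by_cases hj : baseCoset Γ w = j
        · have hδ : δ = ε := by
            have h3 : δ ≠ -ε := fun h => hx ⟨hj, h⟩
            rcases Int.units_eq_one_or ε with rfl | rfl <;>
              rcases Int.units_eq_one_or δ with rfl | rfl <;> simp_all
          subst hj hδ
          rw [Finsupp.single_eq_same]
          exact mul_self_nonneg _
        · simp [hj]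
      obtain ⟨m, m', v, rfl, hm⟩ := ih ((letter Γ (w, δ))⁻¹ • j) (by dsimp only at h; omega)
      refine ⟨(w, δ) :: m, m', v, rfl, ?_⟩
      rw [wordProd_cons, mul_smul, hm, smul_inv_smul]

/-- The sign condition rules out cancellation at `j`. -/
theorem l1norm_single_add {J : Type*} (j : J) (ε : ℤˣ) (f : J →₀ ℤ) (h : 0 ≤ (ε : ℤ) * f j) :
    l1norm (Finsupp.single j (ε : ℤ) + f) = l1norm f + 1 := by
  classical
  have key : ∀ g : J →₀ ℤ, ∀ s : Finset J, insert j f.support = s → g.support ⊆ s →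
      l1norm g = (g j).natAbs + ∑ i ∈ s.erase j, (g i).natAbs := by
    intro g s hs hg
    rw [l1norm, Finsupp.sum_of_support_subset _ hg _ (by simp),
      Finset.add_sum_erase _ (fun i => (g i).natAbs) (by simp [← hs])]
  rw [key _ _ rfl (Finset.subset_insert _ _), key (Finsupp.single j (ε : ℤ) + f) _ rfl]
  · have h1 : ((Finsupp.single j (ε : ℤ) + f) j).natAbs = (f j).natAbs + 1 := by
      rw [Finsupp.add_apply, Finsupp.single_eq_same]
      rcases Int.units_eq_one_or ε with rfl | rfl <;> simp at h ⊢ <;> omega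
    rw [h1, add_right_comm]
    congr 2
    refine Finset.sum_congr rfl fun i hi => ?_
    rw [Finsupp.add_apply, Finsupp.single_eq_of_ne (Finset.ne_of_mem_erase hi), zero_add]
  · refine Finsupp.support_add.trans ?_
    rw [Finset.insert_eq]
    exact Finset.union_subset_union_left Finsupp.support_single_subset

/-- The cocycle of a word of minimal length has `ℓ¹`-norm equal to the length of the word. -/
theorem l1norm_cocycle_wordProd (l : List (V × ℤˣ))
    (hl : ∀ l', wordProd Γ l' = wordProd Γ l → l.length ≤ l'.length) :
    l1norm (cocycle Γ (wordProd Γ l)) = l.length := by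
  induction l with
  | nil => simp [cocycle_one, l1norm]
  | cons x l ih =>
    obtain ⟨v, ε⟩ := x
    have ih' := ih fun l' h => by simpa using hl ((v, ε) :: l') (by simp [h])
    rw [wordProd_cons, cocycle_mul, cocycle_letter, l1norm_single_add, l1norm_shift, ih',
      List.length_cons]
    -- Cancellation would mean that a later letter `v^(-ε)` crosses the base coset of `v`. The
    -- prefix `m` before it then lies in the star subgroup of `v`, so it commutes with `v`; deleting
    -- the two opposite letters gives a shorter word for the same element.
    by_contra! hneg
    rw [shift_apply, (smul_baseCoset_eq_iff _ _).2 (inv_mem (letter_mem_starSubgroup (v, ε)))]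
      at hneg
    obtain ⟨m, m', w, rfl, hm⟩ := exists_crossing ε l _ hneg
    obtain rfl : w = v := congrArg Sigma.fst hm
    have hcomm := (vertexGen_commute_of_mem_starSubgroup
      ((smul_baseCoset_eq_iff _ _).1 hm)).zpow_left (ε : ℤ)
    have := hl (m ++ m') (by
      simp only [wordProd_append, wordProd_cons, letter, Units.val_neg, zpow_neg]
      rw [← mul_assoc, hcomm.eq, mul_assoc, mul_inv_cancel_left])
    simp at this

theorem finite_setOf_l1norm_cocycle_le [Finite V] (M : ℕ) :
    {g : Artin Γ | l1norm (cocycle Γ g) ≤ M}.Finite := by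
  refine ((List.finite_length_le (V × ℤˣ) M).image (wordProd Γ)).subset fun g hg => ?_
  obtain ⟨l, rfl⟩ := exists_wordProd_eq g
  obtain ⟨l₀, hl₀, hmin⟩ := exists_minimalFor_of_wellFoundedLT
    (fun l' => wordProd Γ l' = wordProd Γ l) List.length ⟨l, rfl⟩
  refine ⟨l₀, ?_, hl₀⟩
  rw [Set.mem_ofPred_eq, ← l1norm_cocycle_wordProd l₀ fun l' h =>
    (le_total _ _).elim id (hmin (h.trans hl₀)), hl₀]
  exact hg

end Cocycle

/-! ### Comparison of the two word metrics -/

theorem isUndistorted_of_isStarFree {V : Type*} [Finite V] {Γ : SimpleGraph V}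
    {H : Subgroup (Artin Γ)} (hfg : H.FG) (hstar : IsStarFree H) : IsUndistorted H := by
  have hG : Group.FG (Artin Γ) :=
    Group.fg_iff.2 ⟨_, closure_range_vertexGen, Set.finite_range _⟩
  refine ⟨hG, hfg, fun S T hS hSgen hT hTgen => ?_⟩
  obtain ⟨R, hR⟩ := wordLength_le_card_support_of_free_action (J := StarCoset Γ) hS hSgen
    (fun x ⟨v, a⟩ hx => by
      induction a using QuotientGroup.induction_on with
      | H a =>
        by_contra hne
        exact hstar x x.2 (by simpa using hne) a v ((smul_sigma_mk_eq_iff _ _ _).1 hx))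
    (fun x : H => cocycle Γ x) (fun x y j => cocycle_mul_apply _ _ _)
    (fun M => (finite_setOf_l1norm_cocycle_le M).preimage Subtype.val_injective.injOn)
  obtain ⟨C, hC⟩ := exists_le_mul_wordLength hT hTgen (fun g => (cocycle Γ g).support.card)
    (by simp [cocycle_one]) card_support_cocycle_mul_le
  obtain ⟨C', hC'⟩ := exists_le_mul_wordLength hS hSgen (fun h : H => wordLength T (h : Artin Γ))
    (by simp [wordLength_one]) (fun x y => by simpa using wordLength_mul_le hTgen (x : Artin Γ) y)
  have hlower : ∀ x : H, wordLength S x ≤ R * C * wordLength T (x : Artin Γ) + R := by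
    intro x
    calc wordLength S x ≤ R * ((cocycle Γ x).support.card + 1) := hR x
      _ ≤ R * (C * wordLength T (x : Artin Γ) + 1) := by gcongr; exact hC _
      _ = _ := by ring
  -- The multiplicative constant dominates both `R * C` (lower bound) and `C'` (upper bound); since
  -- it is at least `1`, dividing by it leaves an additive error of at most `R`.
  refine ⟨R * C + C' + 1, R, by
    linarith [show (0 : ℝ) ≤ R * C + C' by positivity], by positivity, fun x y => ?_⟩
  have h1 : (wordLength S (x⁻¹ * y) : ℝ) ≤
      R * C * wordLength T ((x : Artin Γ)⁻¹ * y) + R := by exact_mod_cast hlower (x⁻¹ * y)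
  have h2 : (wordLength T ((x : Artin Γ)⁻¹ * y) : ℝ) ≤ C' * wordLength S (x⁻¹ * y) := by
    exact_mod_cast hC' (x⁻¹ * y)
  simp only [wordDist]
  set s : ℝ := (wordLength S (x⁻¹ * y) : ℝ)
  set t : ℝ := (wordLength T ((x : Artin Γ)⁻¹ * y) : ℝ)
  have hs : 0 ≤ s := Nat.cast_nonneg _
  have ht : 0 ≤ t := Nat.cast_nonneg _
  have hRC : (0 : ℝ) ≤ R * C := by positivity
  have hC0 : (0 : ℝ) ≤ C' := by positivity
  have hR0 : (0 : ℝ) ≤ R := by positivity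
  constructor
  · rw [sub_le_iff_le_add, one_div_mul_eq_div, div_le_iff₀ (by positivity)]
    nlinarith [mul_nonneg hC0 ht, mul_nonneg hR0 hRC, mul_nonneg hR0 hC0]
  · nlinarith [mul_nonneg hRC hs]

end RAAG

theorem proposition4p4 {V : Type*} [Finite V] (Γ : SimpleGraph V)
    (hconn : Γ.Connected) (hanti : RAAG.IsAnticonnected Γ)
    (H : Subgroup (RAAG.Artin Γ)) (hfg : H.FG) (hstar : RAAG.IsStarFree H) :
    RAAG.IsUndistorted H :=
  RAAG.isUndistorted_of_isStarFree hfg hstar
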